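/- Let $K$ be a field and let $S\subseteq T\subseteq\mathbb N_0$ be numerical monoids, i.e. submonoids of $(\mathbb N_0,+)$ with finite complement. Let $K[S]\subseteq K[T]\subseteq K[X]$ be their monoid algebras, where $K[S]$ is the set of polynomials all of whose exponents lie in $S$. For a domain $D$ with quotient field $Q$ and a non-zero fractional ideal $I$ of $D$ put $I^{-1}=\{x\in Q: xI\subseteq D\}$ and $I_v=(I^{-1})^{-1}$; $I$ is a fractional $v$-ideal if $I=I_v$, and it is $v$-invertible if moreover $(IJ)_v=D$ for some fractional $v$-ideal $J$. The $v$-class group $\mathcal C_v(D)$ is the group of $v$-invertible fractional $v$-ideals under $I\cdot_v J=(IJ)_v$, modulo the non-zero principal fractional ideals; $[I]$ denotes the class of $I$. A prime divisor of $D$ is a $v$-invertible prime ideal of height one. Then for every $f\in K[X]$ with $f(0)\neq 0$ the ideal $fK[X]\cap K[S]$ is a $v$-invertible $v$-ideal of $K[S]$ (and likewise for $T$), every class of $\mathcal C_v(K[S])$ contains an ideal of this form, and there is a surjective group homomorphism $$\Theta:\mathcal C_v(K[S])\to\mathcal C_v(K[T]),\qquad [fK[X]\cap K[S]]\mapsto[fK[X]\cap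 K[T]],$$ the formula holding for every $f\in K[X]$ for which $fK[X]\cap K[S]$ is a $v$-invertible $v$-ideal (in which case $fK[X]\cap K[T]$ is one too), such that 1. if a class $c\in\mathcal C_v(K[S])$ contains a prime divisor of $K[S]$, then $\Theta(c)$ contains a prime divisor of $K[T]$; 2. if $c$ contains infinitely many prime divisors of $K[S]$, then $\Theta(c)$ contains infinitely many prime divisors of $K[T]$; 3. $c\in\ker\Theta$ if and only if $c$ contains $fK[X]\cap K[S]$ for some $f\in K[T]$ with $f(0)\neq0$. -/

import Mathlib

open scoped nonZeroDivisors Polynomial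

noncomputable section

section VIdeals

variable {D : Type*} [CommRing D] [IsDomain D]

/-- The `v`-closure `I_v = (I⁻¹)⁻¹` of a fractional ideal `I` of the domain `D`, where
`I⁻¹ = (D : I) = {x | x I ⊆ D}` inside the quotient field of `D` (for `I = 0` this gives `0`). -/
def vClosure (I : FractionalIdeal D⁰ (FractionRing D)) : FractionalIdeal D⁰ (FractionRing D) :=
  (I⁻¹)⁻¹

theorem vClosure_zero : vClosure (0 : FractionalIdeal D⁰ (FractionRing D)) = 0 := by
  simp [vClosure, FractionalIdeal.inv_zero']

theorem vClosure_one : vClosure (1 : FractionalIdeal D⁰ (FractionRing D)) = 1 := by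
  simp [vClosure]

theorem fractionalIdeal_inv_ne_zero {I : FractionalIdeal D⁰ (FractionRing D)} (hI : I ≠ 0) :
    I⁻¹ ≠ 0 := by
  intro h
  obtain ⟨a, ha, hI'⟩ := I.isFractional
  have hmem : algebraMap D (FractionRing D) a ∈ I⁻¹ := by
    rw [FractionalIdeal.mem_inv_iff hI]
    intro y hy
    obtain ⟨d, hd⟩ := hI' y hy
    rw [FractionalIdeal.mem_one_iff]
    exact ⟨d, by rw [hd, Algebra.smul_def]⟩
  rw [h, FractionalIdeal.mem_zero_iff] at hmem
  exact nonZeroDivisors.ne_zero ha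
    ((IsFractionRing.injective D (FractionRing D)) (by rw [hmem, map_zero]))

theorem le_inv_iff_mul_le_one {I J : FractionalIdeal D⁰ (FractionRing D)} (hI : I ≠ 0) :
    J ≤ I⁻¹ ↔ J * I ≤ 1 := by
  rw [FractionalIdeal.inv_eq, FractionalIdeal.le_div_iff_mul_le hI]

theorem le_vClosure (I : FractionalIdeal D⁰ (FractionRing D)) : I ≤ vClosure I := by
  by_cases hI : I = 0
  · rw [hI]; exact FractionalIdeal.zero_le _
  · rw [vClosure, le_inv_iff_mul_le_one (fractionalIdeal_inv_ne_zero hI), mul_comm,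
      ← le_inv_iff_mul_le_one hI]

theorem inv_anti_fractionalIdeal {I J : FractionalIdeal D⁰ (FractionRing D)} (hI : I ≠ 0)
    (h : I ≤ J) : J⁻¹ ≤ I⁻¹ := by
  have hJ : J ≠ 0 := by
    rintro rfl
    exact hI (le_antisymm h (FractionalIdeal.zero_le _))
  rw [le_inv_iff_mul_le_one hI]
  exact (mul_le_mul_right h _).trans ((le_inv_iff_mul_le_one hJ).1 le_rfl)

theorem inv_vClosure {I : FractionalIdeal D⁰ (FractionRing D)} (hI : I ≠ 0) :
    (vClosure I)⁻¹ = I⁻¹ :=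
  le_antisymm (inv_anti_fractionalIdeal hI (le_vClosure I)) (le_vClosure I⁻¹)

theorem vClosure_vClosure (I : FractionalIdeal D⁰ (FractionRing D)) :
    vClosure (vClosure I) = vClosure I := by
  by_cases hI : I = 0
  · simp [hI, vClosure_zero]
  · change ((vClosure I)⁻¹)⁻¹ = _
    rw [inv_vClosure hI, vClosure]

theorem fractionalIdeal_mul_ne_zero {I J : FractionalIdeal D⁰ (FractionRing D)}
    (hI : I ≠ 0) (hJ : J ≠ 0) : I * J ≠ 0 := by
  intro h
  apply hI
  rw [FractionalIdeal.eq_zero_iff]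
  intro x hx
  by_contra hx0
  apply hJ
  rw [FractionalIdeal.eq_zero_iff]
  intro y hy
  have hxy := FractionalIdeal.mul_mem_mul hx hy
  rw [h, FractionalIdeal.mem_zero_iff] at hxy
  exact (mul_eq_zero.1 hxy).resolve_left hx0

theorem vClosure_mul_left (I J : FractionalIdeal D⁰ (FractionRing D)) :
    vClosure (vClosure I * J) = vClosure (I * J) := by
  by_cases hI : I = 0
  · simp [hI, vClosure_zero]
  by_cases hJ : J = 0
  · simp [hJ]
  have hvI : vClosure I ≠ 0 := fractionalIdeal_inv_ne_zero (fractionalIdeal_inv_ne_zero hI)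
  have key : (vClosure I * J)⁻¹ = (I * J)⁻¹ := by
    apply le_antisymm
    · exact inv_anti_fractionalIdeal (fractionalIdeal_mul_ne_zero hI hJ) (mul_le_mul_left (le_vClosure I) J)
    · have h : (I * J)⁻¹ * (I * J) ≤ 1 := (le_inv_iff_mul_le_one (fractionalIdeal_mul_ne_zero hI hJ)).1 le_rfl
      rw [le_inv_iff_mul_le_one (fractionalIdeal_mul_ne_zero hvI hJ), mul_comm (vClosure I), ← mul_assoc,
        ← le_inv_iff_mul_le_one hvI, inv_vClosure hI, le_inv_iff_mul_le_one hI, mul_assoc,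
        mul_comm J]
      exact h
  rw [vClosure, key, vClosure]

theorem vClosure_spanSingleton (x : FractionRing D) :
    vClosure (FractionalIdeal.spanSingleton D⁰ x) = FractionalIdeal.spanSingleton D⁰ x := by
  simp [vClosure, FractionalIdeal.spanSingleton_inv]

variable (D) in
/-- The fractional `v`-ideals of a domain `D`: fractional ideals `I` with `I_v = I`. -/
@[ext]
structure FractionalVIdeal where
  toFractionalIdeal : FractionalIdeal D⁰ (FractionRing D)
  vClosure_eq : vClosure toFractionalIdeal = toFractionalIdeal

/-- The fractional `v`-ideals form a commutative monoid under `v`-multiplication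
`I ·_v J = (I J)_v`, with identity element `D`. -/
instance : CommMonoid (FractionalVIdeal D) where
  mul I J := ⟨vClosure (I.toFractionalIdeal * J.toFractionalIdeal), vClosure_vClosure _⟩
  one := ⟨1, vClosure_one⟩
  mul_assoc I J L := FractionalVIdeal.ext (by
    change vClosure (vClosure (I.toFractionalIdeal * J.toFractionalIdeal) * L.toFractionalIdeal)
      = vClosure (I.toFractionalIdeal * vClosure (J.toFractionalIdeal * L.toFractionalIdeal))
    rw [vClosure_mul_left, mul_comm I.toFractionalIdeal (vClosure _), vClosure_mul_left,
      mul_comm (J.toFractionalIdeal * _), mul_assoc])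
  one_mul I := FractionalVIdeal.ext (by
    change vClosure (1 * I.toFractionalIdeal) = _
    rw [one_mul, I.vClosure_eq])
  mul_one I := FractionalVIdeal.ext (by
    change vClosure (I.toFractionalIdeal * 1) = _
    rw [mul_one, I.vClosure_eq])
  mul_comm I J := FractionalVIdeal.ext (by
    change vClosure (I.toFractionalIdeal * J.toFractionalIdeal) = vClosure (_ * _)
    rw [mul_comm])

variable (D) in
/-- Nonzero elements of the quotient field, sent to the principal fractional ideals they
generate. -/
def principalVIdealHom : (FractionRing D)ˣ →* (FractionalVIdeal D)ˣ :=
  Units.map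
    { toFun := fun x => ⟨FractionalIdeal.spanSingleton D⁰ x, vClosure_spanSingleton x⟩
      map_one' := FractionalVIdeal.ext (FractionalIdeal.spanSingleton_one)
      map_mul' := fun x y => FractionalVIdeal.ext (by
        change FractionalIdeal.spanSingleton D⁰ (x * y) =
          vClosure (FractionalIdeal.spanSingleton D⁰ x * FractionalIdeal.spanSingleton D⁰ y)
        rw [FractionalIdeal.spanSingleton_mul_spanSingleton, vClosure_spanSingleton]) }

variable (D) in
/-- The `v`-class group `C_v(D)`: the group of `v`-invertible fractional `v`-ideals (the units of
the monoid of fractional `v`-ideals) modulo the subgroup of nonzero principal fractional ideals. -/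
abbrev VClassGroup : Type _ :=
  (FractionalVIdeal D)ˣ ⧸ (principalVIdealHom D).range

/-- The ideal `I` of `D` is a `v`-invertible `v`-ideal. -/
def IsVInvertible (I : Ideal D) : Prop :=
  ∃ u : (FractionalVIdeal D)ˣ,
    (u : FractionalVIdeal D).toFractionalIdeal = (I : FractionalIdeal D⁰ (FractionRing D))

/-- The class `c ∈ C_v(D)` contains the ideal `I`, that is, `I` is a `v`-invertible `v`-ideal and
`[I] = c`. -/
def VClassContains (c : VClassGroup D) (I : Ideal D) : Prop :=
  ∃ u : (FractionalVIdeal D)ˣ,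
    (u : FractionalVIdeal D).toFractionalIdeal = (I : FractionalIdeal D⁰ (FractionRing D)) ∧
      (QuotientGroup.mk u : VClassGroup D) = c

/-- A prime divisor of `D`: a `v`-invertible prime ideal of height one. -/
def IsPrimeDivisor (P : Ideal D) : Prop :=
  P.IsPrime ∧ P.height = 1 ∧ IsVInvertible P

end VIdeals

/-- A numerical monoid: a submonoid of `(ℕ, +)` with finite complement. -/
def IsNumericalMonoid (S : AddSubmonoid ℕ) : Prop :=
  ((S : Set ℕ)ᶜ).Finite

/-- The monoid algebra `K[S]` of a submonoid `S ⊆ ℕ`, realized inside `K[X]` as the subalgebra of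
all polynomials whose exponents lie in `S`. -/
def monoidAlg (K : Type*) [Field K] (S : AddSubmonoid ℕ) : Subalgebra K K[X] where
  carrier := {f | ∀ n, f.coeff n ≠ 0 → n ∈ S}
  mul_mem' := by
    intro f g hf hg n hn
    rw [Polynomial.coeff_mul] at hn
    obtain ⟨⟨i, j⟩, hij, h⟩ := Finset.exists_ne_zero_of_sum_ne_zero hn
    rw [← Finset.HasAntidiagonal.mem_antidiagonal.1 hij]
    exact S.add_mem (hf _ (left_ne_zero_of_mul h)) (hg _ (right_ne_zero_of_mul h))
  add_mem' := by
    intro f g hf hg n hn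
    by_cases h : f.coeff n = 0
    · exact hg n fun h' => hn (by rw [Polynomial.coeff_add, h, h', add_zero])
    · exact hf n h
  algebraMap_mem' := by
    intro r n hn
    by_cases h : n = 0
    · rw [h]; exact S.zero_mem
    · exact absurd (by rw [Polynomial.algebraMap_apply, Polynomial.coeff_C, if_neg h]) hn

/-- The ideal `fK[X] ∩ K[S]` of `K[S]`. -/
def contractedIdeal {K : Type*} [Field K] (S : AddSubmonoid ℕ) (f : K[X]) :
    Ideal (monoidAlg K S) :=
  (Ideal.span {f}).comap (algebraMap (monoidAlg K S) K[X])

end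

/-! Both class groups are quotients of one and the same monoid, the polynomials `f` with `f(0) ≠ 0`.
Since `f` is coprime to every power of `X`, and `X^c K[X] ⊆ K[S]` for large `c`, the map `f ↦ fK[X]
∩ K[S]` is multiplicative on this monoid (`contractedIdeal_mul`). Some multiple of `f` lies in
`K[S]` and has nonzero constant term, so each such ideal divides a principal one and is invertible.
The ideal is principal exactly when `f ∈ K[S]` (`vClassContains_one_contractedIdeal_iff`).

These ideals meet every class: if `u` is `v`-invertible, then `u u⁻¹` is not contained in the ideal
`m` of polynomials without constant term, because `X^(c-1)` with `c` the conductor sends `m` into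
`K[S]` without lying in `K[S]`. So some multiple of `u` is an ideal outside `m`, and such ideals are
contracted from `K[X]` (`exists_eq_contractedIdeal`).

As `K[S] ⊆ K[T]`, the relation defining the class group of `K[S]` is finer than that of `K[T]`; this
yields `Θ`, its surjectivity and its kernel. For `S ≠ ℕ` the prime divisors are the ideals given by
irreducible `f` with `f(0) ≠ 0`, so each is contracted from a prime divisor of `K[T]`. -/

open Polynomial

/-! ### `v`-invertible ideals in an arbitrary domain. -/

section VInvertibility

variable {D : Type*} [CommRing D] [IsDomain D]

theorem vClosure_mul_right (I J : FractionalIdeal D⁰ (FractionRing D)) :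
    vClosure (I * vClosure J) = vClosure (I * J) := by
  rw [mul_comm, vClosure_mul_left, mul_comm]

theorem FractionalVIdeal.coe_mul (I J : FractionalVIdeal D) :
    (I * J).toFractionalIdeal = vClosure (I.toFractionalIdeal * J.toFractionalIdeal) := rfl

theorem FractionalVIdeal.coe_one : (1 : FractionalVIdeal D).toFractionalIdeal = 1 := rfl

theorem coe_principalVIdealHom (x : (FractionRing D)ˣ) :
    (principalVIdealHom D x : FractionalVIdeal D).toFractionalIdeal =
      FractionalIdeal.spanSingleton D⁰ (x : FractionRing D) := rfl

variable (D) in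
/-- The `v`-closure as a homomorphism from fractional ideals to fractional `v`-ideals. -/
noncomputable def vClosureHom :
    FractionalIdeal D⁰ (FractionRing D) →* FractionalVIdeal D where
  toFun I := ⟨vClosure I, vClosure_vClosure I⟩
  map_one' := FractionalVIdeal.ext vClosure_one
  map_mul' I J := FractionalVIdeal.ext (by
    rw [FractionalVIdeal.coe_mul, vClosure_mul_left, vClosure_mul_right])

theorem vClosure_eq_self_of_mul_eq_one {I J : FractionalIdeal D⁰ (FractionRing D)}
    (h : I * J = 1) : vClosure I = I := by
  rw [vClosure, ← FractionalIdeal.right_inverse_eq _ I J h]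
  exact (FractionalIdeal.right_inverse_eq _ J I (by rw [mul_comm, h])).symm

/-- An ideal that divides a nonzero principal ideal is `v`-invertible. -/
theorem isVInvertible_of_mul_eq_span {I J : Ideal D} {x : D} (hx : x ≠ 0)
    (h : I * J = Ideal.span {x}) : IsVInvertible I := by
  have hx' : algebraMap D (FractionRing D) x ≠ 0 := by simpa using hx
  have hIJ : (I : FractionalIdeal D⁰ (FractionRing D)) *
      (J * FractionalIdeal.spanSingleton D⁰ (algebraMap D (FractionRing D) x)⁻¹) = 1 := by
    rw [← mul_assoc, ← FractionalIdeal.coeIdeal_mul, h, FractionalIdeal.coeIdeal_span_singleton,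
      FractionalIdeal.spanSingleton_mul_spanSingleton, mul_inv_cancel₀ hx',
      FractionalIdeal.spanSingleton_one]
  exact ⟨Units.map (vClosureHom D) (Units.mkOfMulEqOne _ _ hIJ),
    vClosure_eq_self_of_mul_eq_one hIJ⟩

theorem FractionalVIdeal.units_ext {u w : (FractionalVIdeal D)ˣ}
    (h : (u : FractionalVIdeal D).toFractionalIdeal =
      (w : FractionalVIdeal D).toFractionalIdeal) : u = w :=
  Units.ext (FractionalVIdeal.ext h)

theorem VClassContains.unique {c c' : VClassGroup D} {I : Ideal D}
    (h : VClassContains c I) (h' : VClassContains c' I) : c = c' := by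
  obtain ⟨u, hu, rfl⟩ := h
  obtain ⟨w, hw, rfl⟩ := h'
  rw [FractionalVIdeal.units_ext (hu.trans hw.symm)]

theorem VClassContains.isVInvertible {c : VClassGroup D} {I : Ideal D}
    (h : VClassContains c I) : IsVInvertible I := by
  obtain ⟨u, hu, -⟩ := h
  exact ⟨u, hu⟩

theorem FractionalVIdeal.mul_le_one (u : (FractionalVIdeal D)ˣ) :
    (u : FractionalVIdeal D).toFractionalIdeal *
      ((u⁻¹ : (FractionalVIdeal D)ˣ) : FractionalVIdeal D).toFractionalIdeal ≤ 1 := by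
  refine (le_vClosure _).trans (le_of_eq ?_)
  rw [← FractionalVIdeal.coe_mul, Units.mul_inv, FractionalVIdeal.coe_one]

/-- If `I` is `v`-invertible, then the only elements multiplying `I I⁻¹` into `D` are those of
`D`. -/
theorem FractionalVIdeal.mem_one_of_forall_mul_mem (u : (FractionalVIdeal D)ˣ)
    {z : FractionRing D}
    (hz : ∀ x ∈ (u : FractionalVIdeal D).toFractionalIdeal,
      ∀ y ∈ ((u⁻¹ : (FractionalVIdeal D)ˣ) : FractionalVIdeal D).toFractionalIdeal,
        z * (x * y) ∈ (1 : FractionalIdeal D⁰ (FractionRing D))) :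
    z ∈ (1 : FractionalIdeal D⁰ (FractionRing D)) := by
  set I := (u : FractionalVIdeal D).toFractionalIdeal
  set J := ((u⁻¹ : (FractionalVIdeal D)ˣ) : FractionalVIdeal D).toFractionalIdeal
  have hIJ : vClosure (I * J) = 1 := by
    rw [← FractionalVIdeal.coe_mul, Units.mul_inv, FractionalVIdeal.coe_one]
  have h0 : I * J ≠ 0 := by
    intro h
    rw [h, vClosure_zero] at hIJ
    exact zero_ne_one hIJ
  -- An ideal and its `v`-closure have the same inverse, so `(IJ)⁻¹ = D⁻¹ = D`.
  rw [← inv_one (G := FractionalIdeal D⁰ (FractionRing D)), ← hIJ, inv_vClosure h0,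
    FractionalIdeal.mem_inv_iff h0]
  intro w hw
  refine FractionalIdeal.mul_induction_on hw hz fun a b ha hb => ?_
  rw [mul_add]
  exact Submodule.add_mem _ ha hb

/-- The multiplier ring of a `v`-invertible ideal of `D` is `D`. -/
theorem IsVInvertible.dvd_of_forall_mul_mem {I : Ideal D} (hI : IsVInvertible I) {p q : D}
    (hq : q ≠ 0) (h : ∀ a ∈ I, ∃ b ∈ I, p * a = q * b) : q ∣ p := by
  obtain ⟨u, hu⟩ := hI
  have hq' : algebraMap D (FractionRing D) q ≠ 0 := by simpa using hq
  have key := FractionalVIdeal.mem_one_of_forall_mul_mem u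
    (z := algebraMap D (FractionRing D) p / algebraMap D (FractionRing D) q) (by
      intro x hx y hy
      rw [hu] at hx
      obtain ⟨a, ha, rfl⟩ := (FractionalIdeal.mem_coeIdeal _).1 hx
      obtain ⟨b, hb, hab⟩ := h a ha
      refine FractionalVIdeal.mul_le_one u ?_
      rw [← mul_assoc, div_mul_eq_mul_div, ← map_mul, hab, map_mul, mul_div_cancel_left₀ _ hq']
      refine FractionalIdeal.mul_mem_mul ?_ hy
      rw [hu]
      exact FractionalIdeal.mem_coeIdeal_of_mem _ hb)
  obtain ⟨r, hr⟩ := (FractionalIdeal.mem_one_iff _).1 key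
  refine ⟨r, IsFractionRing.injective D (FractionRing D) ?_⟩
  rw [map_mul, hr, mul_div_cancel₀ _ hq']

/-- Let `m` be an ideal with `p m ⊆ q D` but `q ∤ p`. Every class of the `v`-class group contains
an ideal of `D` that is not contained in `m`. -/
theorem VClassContains.exists_not_le {m : Ideal D} {p q : D} (hq : q ≠ 0) (hqp : ¬ q ∣ p)
    (hm : ∀ a ∈ m, q ∣ p * a) (c : VClassGroup D) :
    ∃ I : Ideal D, VClassContains c I ∧ ¬ I ≤ m := by
  obtain ⟨u, rfl⟩ := QuotientGroup.mk_surjective c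
  set I := (u : FractionalVIdeal D).toFractionalIdeal
  set J := ((u⁻¹ : (FractionalVIdeal D)ˣ) : FractionalVIdeal D).toFractionalIdeal
  have hq' : algebraMap D (FractionRing D) q ≠ 0 := by simpa using hq
  obtain ⟨x, hx, y, hy, a, ha, ham⟩ : ∃ x ∈ I, ∃ y ∈ J, ∃ a, algebraMap D (FractionRing D) a =
      x * y ∧ a ∉ m := by
    -- If `IJ ⊆ m`, then `p / q` multiplies `IJ` into `D`, which forces `p / q ∈ D`.
    by_contra! hcon
    have key := FractionalVIdeal.mem_one_of_forall_mul_mem u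
      (z := algebraMap D (FractionRing D) p / algebraMap D (FractionRing D) q) (by
        intro x hx y hy
        obtain ⟨a, ha⟩ := (FractionalIdeal.mem_one_iff _).1
          (FractionalVIdeal.mul_le_one u (FractionalIdeal.mul_mem_mul hx hy))
        obtain ⟨b, hb⟩ := hm a (hcon x hx y hy a ha)
        refine (FractionalIdeal.mem_one_iff _).2 ⟨b, ?_⟩
        rw [← ha, div_mul_eq_mul_div, ← map_mul, hb, map_mul, mul_div_cancel_left₀ _ hq'])
    obtain ⟨r, hr⟩ := (FractionalIdeal.mem_one_iff _).1 key
    refine hqp ⟨r, IsFractionRing.injective D (FractionRing D) ?_⟩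
    rw [map_mul, hr, mul_div_cancel₀ _ hq']
  have hy0 : y ≠ 0 := by
    rintro rfl
    rw [mul_zero, map_eq_zero_iff _ (IsFractionRing.injective D (FractionRing D))] at ha
    exact ham (ha ▸ m.zero_mem)
  have hle : I * FractionalIdeal.spanSingleton D⁰ y ≤ 1 :=
    le_trans (by gcongr; exact FractionalIdeal.spanSingleton_le_iff_mem.2 hy)
      (FractionalVIdeal.mul_le_one u)
  obtain ⟨L, hL⟩ := FractionalIdeal.le_one_iff_exists_coeIdeal.1 hle
  -- The representative is `yI`: it lies in `D` because `y ∈ I⁻¹`, and it contains `xy ∉ m`.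
  refine ⟨L, ⟨u * principalVIdealHom D (Units.mk0 y hy0), ?_, ?_⟩, fun hLm => ham (hLm ?_)⟩
  · have hLv : (Units.mk0 y hy0 : FractionRing D) = y := rfl
    rw [Units.val_mul, FractionalVIdeal.coe_mul, coe_principalVIdealHom, hLv, hL]
    refine le_antisymm ?_ (le_vClosure _)
    have h1 := (le_vClosure (vClosure (I * FractionalIdeal.spanSingleton D⁰ y) *
      FractionalIdeal.spanSingleton D⁰ y⁻¹))
    rw [vClosure_mul_left, mul_assoc, FractionalIdeal.spanSingleton_mul_spanSingleton,
      mul_inv_cancel₀ hy0, FractionalIdeal.spanSingleton_one, mul_one,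
      (u : FractionalVIdeal D).vClosure_eq] at h1
    have h2 := mul_le_mul_left h1 (FractionalIdeal.spanSingleton D⁰ y)
    rwa [mul_assoc, FractionalIdeal.spanSingleton_mul_spanSingleton,
      inv_mul_cancel₀ hy0, FractionalIdeal.spanSingleton_one, mul_one] at h2
  · rw [QuotientGroup.eq]
    exact ⟨(Units.mk0 y hy0)⁻¹, by simp⟩
  · have : algebraMap D (FractionRing D) a ∈ (L : FractionalIdeal D⁰ (FractionRing D)) := by
      rw [hL, ha]
      exact FractionalIdeal.mul_mem_mul hx (FractionalIdeal.mem_spanSingleton_self _ _)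
    obtain ⟨b, hb, hba⟩ := (FractionalIdeal.mem_coeIdeal _).1 this
    rwa [← IsFractionRing.injective D (FractionRing D) hba]

theorem vClassContains_one_iff {I : Ideal D} :
    VClassContains 1 I ↔ ∃ x : D, x ≠ 0 ∧ I = Ideal.span {x} := by
  constructor
  · rintro ⟨u, hu, h1⟩
    rw [QuotientGroup.eq_one_iff] at h1
    obtain ⟨y, rfl⟩ := h1
    rw [coe_principalVIdealHom] at hu
    have hy : (y : FractionRing D) ∈ (I : FractionalIdeal D⁰ (FractionRing D)) := by
      rw [← hu]
      exact FractionalIdeal.mem_spanSingleton_self _ _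
    obtain ⟨x, -, hxy⟩ := (FractionalIdeal.mem_coeIdeal _).1 hy
    refine ⟨x, ?_, ?_⟩
    · rintro rfl
      exact y.ne_zero (by rw [← hxy, map_zero])
    · rw [← hxy, ← FractionalIdeal.coeIdeal_span_singleton, FractionalIdeal.coeIdeal_inj] at hu
      exact hu.symm
  · rintro ⟨x, hx, rfl⟩
    have hx' : algebraMap D (FractionRing D) x ≠ 0 := by simpa using hx
    refine ⟨principalVIdealHom D (Units.mk0 _ hx'), ?_, ?_⟩
    · rw [coe_principalVIdealHom, FractionalIdeal.coeIdeal_span_singleton, Units.val_mk0]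
    · rw [QuotientGroup.eq_one_iff]
      exact ⟨_, rfl⟩

end VInvertibility

theorem MonoidHom.exists_factor_of_surjective {M G H : Type*} [Monoid M] [Group G] [Group H]
    (φ : M →* G) (ψ : M →* H) (hφ : Function.Surjective φ)
    (h : ∀ a b, φ a = φ b → ψ a = ψ b) : ∃ θ : G →* H, ∀ a, θ (φ a) = ψ a := by
  refine ⟨MonoidHom.mk' (fun g => ψ (Function.surjInv hφ g)) fun a b => ?_,
    fun a => h _ _ (Function.surjInv_eq hφ _)⟩
  rw [← map_mul]
  apply h
  simp only [map_mul, Function.surjInv_eq hφ]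
-- Contractions to `K[S]` of principal ideals of `K[X]`.
section MonoidAlgebra

variable {K : Type*} [Field K] {S T : AddSubmonoid ℕ}

theorem monoidAlg_mono (h : S ≤ T) : monoidAlg K S ≤ monoidAlg K T :=
  fun _ hf n hn => h (hf n hn)

theorem mem_contractedIdeal {f : K[X]} {a : monoidAlg K S} :
    a ∈ contractedIdeal S f ↔ f ∣ (a : K[X]) := by
  rw [contractedIdeal, Ideal.mem_comap, Ideal.mem_span_singleton]
  rfl

theorem X_pow_mul_mem_monoidAlg {c : ℕ} (hc : ∀ n, c ≤ n → n ∈ S) (a : K[X]) :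
    X ^ c * a ∈ monoidAlg K S := by
  intro n hn
  apply hc
  by_contra h
  exact hn (by rw [coeff_X_pow_mul', if_neg h])

theorem X_pow_mem_monoidAlg_iff {n : ℕ} : (X ^ n : K[X]) ∈ monoidAlg K S ↔ n ∈ S := by
  refine ⟨fun h => h n (by simp), fun h m hm => ?_⟩
  rw [coeff_X_pow] at hm
  simp only [ne_eq, ite_eq_right_iff, one_ne_zero, imp_false, not_not] at hm
  exact hm ▸ h

/-- Minimality is phrased through `c = k + 1` to avoid truncated subtraction; it is vacuous for `c =
0`, the case `S = ℕ`. -/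
theorem IsNumericalMonoid.exists_conductor (hS : IsNumericalMonoid S) :
    ∃ c, (∀ n, c ≤ n → n ∈ S) ∧ ∀ k, c = k + 1 → k ∉ S := by
  classical
  have hex : ∃ c, ∀ n, c ≤ n → n ∈ S := by
    obtain ⟨N, hN⟩ := Set.Finite.bddAbove hS
    refine ⟨N + 1, fun n hn => ?_⟩
    by_contra h
    have := hN (show n ∈ (S : Set ℕ)ᶜ from h)
    omega
  refine ⟨Nat.find hex, Nat.find_spec hex, fun k hk hkS => ?_⟩
  refine Nat.find_min hex (m := k) (by omega) fun n hn => ?_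
  rcases hn.eq_or_lt with rfl | h
  · exact hkS
  · exact Nat.find_spec hex n (by omega)

/-- A factor whose cofactor and product lie in `K[S]` lies in `K[S]`, provided that the cofactor
has nonzero constant term. -/
theorem mem_monoidAlg_of_mul_mem {h a : K[X]} (hh : h ∈ monoidAlg K S) (h0 : h.eval 0 ≠ 0)
    (hha : h * a ∈ monoidAlg K S) : a ∈ monoidAlg K S := by
  intro n
  induction n using Nat.strong_induction_on with
  | _ n ih =>
    intro hn
    by_contra hnS
    apply hnS
    apply hha
    rw [coeff_mul, Finset.sum_eq_single (0, n)]
    · rw [coeff_zero_eq_eval_zero]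
      exact mul_ne_zero h0 hn
    · rintro ⟨i, j⟩ hij hne
      rw [Finset.HasAntidiagonal.mem_antidiagonal] at hij
      by_contra hcon
      have hi := hh i (left_ne_zero_of_mul hcon)
      have hlt : j < n := by
        rcases Nat.eq_zero_or_pos i with rfl | hi0
        · exact absurd (by simpa using hij) (fun h => hne (by rw [h]))
        · simp only at hij
          omega
      have hj := ih j hlt (right_ne_zero_of_mul hcon)
      exact hnS (hij ▸ S.add_mem hi hj)
    · intro h
      simp at h

theorem exists_mul_add_mul_X_pow_eq_one {f : K[X]} (hf : f.eval 0 ≠ 0) (N : ℕ) :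
    ∃ a b : K[X], a * f + b * X ^ N = 1 := by
  have h : ¬ (X : K[X]) ∣ f := by rwa [X_dvd_iff, coeff_zero_eq_eval_zero]
  exact ((irreducible_X.coprime_iff_not_dvd.2 h).pow_left (m := N)).symm

theorem dvd_of_dvd_X_pow_mul {f a : K[X]} (hf : f.eval 0 ≠ 0) {N : ℕ} (h : f ∣ X ^ N * a) :
    f ∣ a :=
  IsCoprime.dvd_of_dvd_mul_left (exists_mul_add_mul_X_pow_eq_one hf N) h

theorem mul_mem_monoidAlg_of_add_eq_one {c : ℕ} (hc : ∀ n, c ≤ n → n ∈ S) {N : ℕ} (hN : c ≤ N)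
    {f a b : K[X]} (h : a * f + b * X ^ N = 1) : a * f ∈ monoidAlg K S := by
  rw [eq_sub_of_add_eq h]
  refine sub_mem (one_mem _) ?_
  rw [mul_comm]
  exact X_pow_mul_mem_monoidAlg (fun n hn => hc n (hN.trans hn)) b

theorem exists_mul_mem_monoidAlg (hS : IsNumericalMonoid S) {f : K[X]} (hf : f.eval 0 ≠ 0) :
    ∃ g : K[X], g.eval 0 = (f.eval 0)⁻¹ ∧ g * f ∈ monoidAlg K S := by
  obtain ⟨c, hc, -⟩ := hS.exists_conductor
  -- The exponent `c + 1` rather than `c` makes the power of `X` vanish at `0` even when `c = 0`.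
  obtain ⟨a, b, hab⟩ := exists_mul_add_mul_X_pow_eq_one hf (c + 1)
  refine ⟨a, ?_, mul_mem_monoidAlg_of_add_eq_one hc (Nat.le_succ c) hab⟩
  have := congrArg (eval 0) hab
  simp only [eval_add, eval_mul, eval_pow, eval_X, eval_one, ne_eq, Nat.add_eq_zero_iff,
    one_ne_zero, and_false, not_false_eq_true, zero_pow, mul_zero, add_zero] at this
  exact eq_inv_of_mul_eq_one_left this

/-- For the hard inclusion take `u ≡ 1` and `v ≡ 1` modulo `X^(2c)` with `f ∣ u`, `g ∣ v`. Then `w =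
w·uv + w(1 - uv)`, and the factor `X^(2c)` of `1 - uv` splits into one `X^c` for the multiple of `f`
and one for the multiple of `g`, putting both into `K[S]`. -/
theorem contractedIdeal_mul (hS : IsNumericalMonoid S) {f g : K[X]} (hf : f.eval 0 ≠ 0)
    (hg : g.eval 0 ≠ 0) :
    contractedIdeal S f * contractedIdeal S g = contractedIdeal S (f * g) := by
  apply le_antisymm
  · rw [Ideal.mul_le]
    intro a ha b hb
    rw [mem_contractedIdeal] at ha hb ⊢
    exact mul_dvd_mul ha hb
  · intro w hw
    rw [mem_contractedIdeal] at hw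
    obtain ⟨k, hk⟩ := hw
    obtain ⟨c, hc, -⟩ := hS.exists_conductor
    obtain ⟨a, b, hab⟩ := exists_mul_add_mul_X_pow_eq_one hf (c + c)
    obtain ⟨a', b', hab'⟩ := exists_mul_add_mul_X_pow_eq_one hg (c + c)
    let u : monoidAlg K S := ⟨a * f, mul_mem_monoidAlg_of_add_eq_one hc (by omega) hab⟩
    let v : monoidAlg K S := ⟨a' * g, mul_mem_monoidAlg_of_add_eq_one hc (by omega) hab'⟩
    let p : monoidAlg K S := ⟨X ^ c * f, X_pow_mul_mem_monoidAlg hc f⟩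
    let q : monoidAlg K S := ⟨X ^ c * (g * k * (b + b' - b * b' * X ^ (c + c))),
      X_pow_mul_mem_monoidAlg hc _⟩
    have hw : w = w * (u * v) + p * q := by
      apply Subtype.ext
      change (w : K[X]) = (w : K[X]) * (a * f * (a' * g)) +
        X ^ c * f * (X ^ c * (g * k * (b + b' - b * b' * X ^ (c + c))))
      rw [hk, eq_sub_of_add_eq hab, eq_sub_of_add_eq hab']
      ring
    rw [hw]
    refine add_mem (Ideal.mul_mem_left _ _ (Ideal.mul_mem_mul ?_ ?_))
      (Ideal.mul_mem_mul ?_ ?_) <;> rw [mem_contractedIdeal]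
    · exact Dvd.intro_left _ rfl
    · exact Dvd.intro_left _ rfl
    · exact Dvd.intro_left _ rfl
    · exact Dvd.intro _ (show g * (X ^ c * (k * (b + b' - b * b' * X ^ (c + c)))) =
        X ^ c * (g * k * (b + b' - b * b' * X ^ (c + c))) by ring)

theorem contractedIdeal_eq_span {h : K[X]} (hh : h ∈ monoidAlg K S) (h0 : h.eval 0 ≠ 0) :
    contractedIdeal S h = Ideal.span {⟨h, hh⟩} := by
  ext a
  rw [mem_contractedIdeal, Ideal.mem_span_singleton]
  constructor
  · rintro ⟨k, hk⟩
    have hkS : k ∈ monoidAlg K S := mem_monoidAlg_of_mul_mem hh h0 (hk ▸ a.2)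
    exact ⟨⟨k, hkS⟩, Subtype.ext hk⟩
  · rintro ⟨k, rfl⟩
    exact ⟨k, rfl⟩

theorem isVInvertible_contractedIdeal (hS : IsNumericalMonoid S) {f : K[X]}
    (hf : f.eval 0 ≠ 0) : IsVInvertible (contractedIdeal S f) := by
  obtain ⟨g, hg, hgf⟩ := exists_mul_mem_monoidAlg hS hf
  have hg0 : g.eval 0 ≠ 0 := by rw [hg]; exact inv_ne_zero hf
  have h0 : (g * f).eval 0 ≠ 0 := by rw [eval_mul]; exact mul_ne_zero hg0 hf
  refine isVInvertible_of_mul_eq_span (J := contractedIdeal S g) (x := ⟨g * f, hgf⟩) ?_ ?_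
  · intro h
    apply h0
    rw [show g * f = 0 from congrArg Subtype.val h, eval_zero]
  · rw [contractedIdeal_mul hS hf hg0, mul_comm f g, contractedIdeal_eq_span hgf h0]

theorem exists_eval_ne_zero_of_not_le {I : Ideal (monoidAlg K S)}
    (h : ¬ I ≤ contractedIdeal S X) : ∃ u ∈ I, (u : K[X]).eval 0 ≠ 0 := by
  obtain ⟨u, hu, hu'⟩ := SetLike.not_le_iff_exists.1 h
  refine ⟨u, hu, ?_⟩
  rwa [mem_contractedIdeal, X_dvd_iff, coeff_zero_eq_eval_zero] at hu'

/-- Every ideal of `K[S]` containing a polynomial with nonzero constant term is the contraction of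
an ideal of `K[X]`. -/
theorem exists_eq_contractedIdeal (hS : IsNumericalMonoid S) {I : Ideal (monoidAlg K S)}
    (h : ¬ I ≤ contractedIdeal S X) : ∃ f : K[X], f.eval 0 ≠ 0 ∧ I = contractedIdeal S f := by
  obtain ⟨u, hu, hu0⟩ := exists_eval_ne_zero_of_not_le h
  obtain ⟨c, hc, -⟩ := hS.exists_conductor
  set E : Ideal K[X] := I.map (algebraMap (monoidAlg K S) K[X])
  obtain ⟨f, hf⟩ := (IsPrincipalIdealRing.principal E).principal
  have hfE : f ∈ E := by rw [hf]; exact Submodule.mem_span_singleton_self f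
  have hdvd : ∀ i ∈ I, f ∣ (i : K[X]) := fun i hi => by
    have : (i : K[X]) ∈ E := Ideal.mem_map_of_mem (algebraMap (monoidAlg K S) K[X]) hi
    rw [hf] at this
    exact Ideal.mem_span_singleton.1 this
  -- That is, `X^c E ⊆ I`: the coefficients from `K[X]` are absorbed by `X^c`.
  have key : ∀ e ∈ E, ∀ a : K[X], ∃ i ∈ I, (i : K[X]) = X ^ c * a * e := by
    intro e he
    refine Submodule.span_induction (p := fun e _ => ∀ a : K[X], ∃ i ∈ I,
      (i : K[X]) = X ^ c * a * e) ?_ ?_ ?_ ?_ he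
    · rintro _ ⟨i, hi, rfl⟩ a
      refine ⟨⟨X ^ c * a, X_pow_mul_mem_monoidAlg hc a⟩ * i, I.mul_mem_left _ hi, ?_⟩
      rw [Subalgebra.coe_mul]
      congr 1
    · intro a
      exact ⟨0, I.zero_mem, by simp⟩
    · intro x y _ _ hx hy a
      obtain ⟨i, hi, hix⟩ := hx a
      obtain ⟨j, hj, hjy⟩ := hy a
      exact ⟨i + j, I.add_mem hi hj, by rw [Subalgebra.coe_add, hix, hjy, mul_add]⟩
    · intro r x _ hx a
      obtain ⟨i, hi, hix⟩ := hx (a * r)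
      exact ⟨i, hi, by rw [hix, smul_eq_mul]; ring⟩
  refine ⟨f, fun hf0 => hu0 ?_, le_antisymm (fun i hi => mem_contractedIdeal.2 (hdvd i hi)) ?_⟩
  · obtain ⟨k, hk⟩ := hdvd u hu
    rw [hk, eval_mul, hf0, zero_mul]
  · intro w hw
    obtain ⟨k, hk⟩ := mem_contractedIdeal.1 hw
    -- Splitting `1 = au + bX^c` writes `w` as a `K[S]`-multiple of `u ∈ I` plus an element of `X^c
    -- E ⊆ I`.
    obtain ⟨a, b, hab⟩ := exists_mul_add_mul_X_pow_eq_one hu0 c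
    have hau := mul_mem_monoidAlg_of_add_eq_one hc le_rfl hab
    have ha : a ∈ monoidAlg K S := mem_monoidAlg_of_mul_mem u.2 hu0 (mul_comm a _ ▸ hau)
    obtain ⟨i, hi, hif⟩ := key f hfE (b * k)
    have : w = w * ⟨a, ha⟩ * u + i := by
      apply Subtype.ext
      change (w : K[X]) = (w : K[X]) * a * (u : K[X]) + (i : K[X])
      rw [hif, mul_assoc, eq_sub_of_add_eq hab, hk]
      ring
    rw [this]
    exact I.add_mem (I.mul_mem_left _ hu) hi

/-- With `c` the conductor of `S`, the fraction `X ^ c / X` multiplies the ideal of polynomials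
without constant term into itself, but does not lie in `K[S]`. -/
theorem exists_fraction (hS : IsNumericalMonoid S) :
    ∃ p q : monoidAlg K S, q ≠ 0 ∧ ¬ q ∣ p ∧ (∀ a ∈ contractedIdeal S X, q ∣ p * a) ∧
      (S ≠ ⊤ → ∀ f : K[X], X ∣ f → ∀ a ∈ contractedIdeal S f,
        ∃ b ∈ contractedIdeal S f, p * a = q * b) := by
  obtain ⟨c, hc, hc'⟩ := hS.exists_conductor
  -- The fraction is expanded by `X^c` so that numerator and denominator both lie in `K[S]`.
  have hq : (X ^ (c + 1) : K[X]) ∈ monoidAlg K S := X_pow_mem_monoidAlg_iff.2 (hc _ (by omega))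
  have hp : (X ^ (c + c) : K[X]) ∈ monoidAlg K S := X_pow_mem_monoidAlg_iff.2 (hc _ (by omega))
  refine ⟨⟨_, hp⟩, ⟨_, hq⟩, fun h => ?_, ?_, fun a ha => ?_, fun hST f hf a ha => ?_⟩
  · exact pow_ne_zero (c + 1) (X_ne_zero (R := K)) (congrArg Subtype.val h)
  · rintro ⟨r, hr⟩
    have hr : (X ^ (c + c) : K[X]) = X ^ (c + 1) * (r : K[X]) := congrArg Subtype.val hr
    rcases c with _ | k
    · have := congrArg (eval 0) hr
      simp at this
    · have hr' : (r : K[X]) = X ^ k := by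
        apply mul_left_cancel₀ (pow_ne_zero (k + 1 + 1) (X_ne_zero (R := K)))
        rw [← hr]
        ring
      exact hc' k rfl (X_pow_mem_monoidAlg_iff.1 (hr' ▸ r.2))
  · obtain ⟨k, hk⟩ := mem_contractedIdeal.1 ha
    refine ⟨⟨X ^ c * k, X_pow_mul_mem_monoidAlg hc k⟩, Subtype.ext ?_⟩
    change X ^ (c + c) * (a : K[X]) = X ^ (c + 1) * (X ^ c * k)
    rw [hk]
    ring
  · obtain ⟨k, hk⟩ := mem_contractedIdeal.1 ha
    obtain ⟨l, rfl⟩ := hf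
    rcases c with _ | d
    · exact absurd (eq_top_iff.2 fun n _ => hc n n.zero_le) hST
    refine ⟨⟨X ^ (d + 1) * (l * k), X_pow_mul_mem_monoidAlg hc _⟩,
      mem_contractedIdeal.2 ⟨X ^ d * k, ?_⟩, Subtype.ext ?_⟩
    · change X ^ (d + 1) * (l * k) = X * l * (X ^ d * k)
      ring
    · change X ^ (d + 1 + (d + 1)) * (a : K[X]) = X ^ (d + 1 + 1) * (X ^ (d + 1) * (l * k))
      rw [hk]
      ring

/-- If `X ∣ f`, the fraction of `exists_fraction` stabilizes the ideal, yet the multiplier ring of a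
`v`-invertible ideal is `K[S]`. For `S = ℕ` this fails: `XK[X]` is principal. -/
theorem eval_ne_zero_of_isVInvertible (hS : IsNumericalMonoid S) (hS' : S ≠ ⊤) {f : K[X]}
    (h : IsVInvertible (contractedIdeal S f)) : f.eval 0 ≠ 0 := by
  intro hf
  rw [← coeff_zero_eq_eval_zero, ← X_dvd_iff] at hf
  obtain ⟨p, q, hq, hqp, -, hpq⟩ := exists_fraction (K := K) hS
  exact hqp (h.dvd_of_forall_mul_mem hq (hpq hS' f hf))

theorem exists_vClassContains_contractedIdeal (hS : IsNumericalMonoid S)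
    (c : VClassGroup (monoidAlg K S)) :
    ∃ f : K[X], f.eval 0 ≠ 0 ∧ VClassContains c (contractedIdeal S f) := by
  obtain ⟨p, q, hq, hqp, hm, -⟩ := exists_fraction (K := K) hS
  obtain ⟨I, hI, hIm⟩ := VClassContains.exists_not_le hq hqp hm c
  obtain ⟨f, hf, rfl⟩ := exists_eq_contractedIdeal hS hIm
  exact ⟨f, hf, hI⟩

/-- A generator `x` satisfies `f ∣ x`, and `x ∣ X^c f`. A multiple of `f` with nonzero constant term
is divisible by `x`, so `x(0) ≠ 0` and hence `x ∣ f`. Thus `f` is a constant times `x`. -/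
theorem vClassContains_one_contractedIdeal_iff (hS : IsNumericalMonoid S) {f : K[X]}
    (hf : f.eval 0 ≠ 0) :
    VClassContains 1 (contractedIdeal S f) ↔ f ∈ monoidAlg K S := by
  rw [vClassContains_one_iff]
  constructor
  · rintro ⟨x, hx, hfx⟩
    obtain ⟨c, hc, -⟩ := hS.exists_conductor
    obtain ⟨g, hg, hgf⟩ := exists_mul_mem_monoidAlg hS hf
    have h1 : (⟨g * f, hgf⟩ : monoidAlg K S) ∈ contractedIdeal S f :=
      mem_contractedIdeal.2 (Dvd.intro_left _ rfl)
    rw [hfx, Ideal.mem_span_singleton] at h1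
    obtain ⟨r, hr⟩ := h1
    have hr : g * f = (x : K[X]) * (r : K[X]) := congrArg Subtype.val hr
    have hx0 : (x : K[X]).eval 0 ≠ 0 := by
      intro h
      have := congrArg (eval 0) hr
      rw [eval_mul, eval_mul, h, hg, zero_mul, inv_mul_cancel₀ hf] at this
      exact one_ne_zero this
    have hfx' : f ∣ x := by
      rw [← mem_contractedIdeal, hfx]
      exact Ideal.mem_span_singleton_self x
    have hxf : (x : K[X]) ∣ f := by
      have h2 : (⟨X ^ c * f, X_pow_mul_mem_monoidAlg hc f⟩ : monoidAlg K S) ∈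
          contractedIdeal S f := mem_contractedIdeal.2 (Dvd.intro_left _ rfl)
      rw [hfx, Ideal.mem_span_singleton] at h2
      obtain ⟨s, hs⟩ := h2
      exact dvd_of_dvd_X_pow_mul hx0 ⟨s, congrArg Subtype.val hs⟩
    obtain ⟨v, hv⟩ := associated_of_dvd_dvd hxf hfx'
    obtain ⟨a, -, ha⟩ := Polynomial.isUnit_iff.1 v.isUnit
    rw [← hv, ← ha]
    exact mul_mem x.2 ((monoidAlg K S).algebraMap_mem a)
  · intro hfS
    refine ⟨⟨f, hfS⟩, fun h => hf ?_, contractedIdeal_eq_span hfS hf⟩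
    rw [show f = 0 from congrArg Subtype.val h, eval_zero]

variable (K) in
/-- The polynomials with nonzero constant term. -/
def nonzeroConstantTerm : Submonoid K[X] where
  carrier := {f | f.eval 0 ≠ 0}
  one_mem' := by simp
  mul_mem' := fun hf hg => by
    simp only [Set.mem_ofPred_eq, eval_mul] at hf hg ⊢
    exact mul_ne_zero hf hg

theorem coe_contractedIdeal_unit_mul (hS : IsNumericalMonoid S) {f g : K[X]}
    (hf : f.eval 0 ≠ 0) (hg : g.eval 0 ≠ 0) {u v w : (FractionalVIdeal (monoidAlg K S))ˣ}
    (hu : (u : FractionalVIdeal (monoidAlg K S)).toFractionalIdeal = contractedIdeal S f)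
    (hv : (v : FractionalVIdeal (monoidAlg K S)).toFractionalIdeal = contractedIdeal S g)
    (hw : (w : FractionalVIdeal (monoidAlg K S)).toFractionalIdeal =
      contractedIdeal S (f * g)) : w = u * v := by
  apply FractionalVIdeal.units_ext
  rw [Units.val_mul, FractionalVIdeal.coe_mul, hu, hv, ← FractionalIdeal.coeIdeal_mul,
    contractedIdeal_mul hS hf hg, ← hw]
  exact (w : FractionalVIdeal (monoidAlg K S)).vClosure_eq.symm

theorem exists_contractedIdeal_class_hom (hS : IsNumericalMonoid S) :
    ∃ φ : nonzeroConstantTerm K →* VClassGroup (monoidAlg K S),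
      ∀ f, VClassContains (φ f) (contractedIdeal S (f : K[X])) := by
  choose u hu using fun f : nonzeroConstantTerm K => isVInvertible_contractedIdeal hS f.2
  have hmul : ∀ f g, u (f * g) = u f * u g := fun f g =>
    coe_contractedIdeal_unit_mul hS f.2 g.2 (hu f) (hu g) (hu (f * g))
  have hone : u 1 = 1 := by
    have := hmul 1 1
    rwa [one_mul, left_eq_mul] at this
  exact ⟨{ toFun f := QuotientGroup.mk (u f)
           map_one' := by rw [hone, QuotientGroup.mk_one]
           map_mul' f g := by rw [hmul, QuotientGroup.mk_mul] }, fun f => ⟨u f, hu f, rfl⟩⟩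

theorem comap_contractedIdeal (hST : S ≤ T) (f : K[X]) :
    (contractedIdeal T f).comap (Subalgebra.inclusion (monoidAlg_mono (K := K) hST)) =
      contractedIdeal S f := by
  ext a
  rw [Ideal.mem_comap, mem_contractedIdeal, mem_contractedIdeal]
  rfl

/-! ### Prime divisors of `K[S]`. -/

/-- A nonzero prime ideal of polynomials without constant term contains all of these. -/
theorem contractedIdeal_X_le (hS : IsNumericalMonoid S) {P : Ideal (monoidAlg K S)}
    (hP : P.IsPrime) (h0 : P ≠ ⊥) (h : P ≤ contractedIdeal S X) : contractedIdeal S X ≤ P := by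
  obtain ⟨c, hc, -⟩ := hS.exists_conductor
  obtain ⟨p, hp, hp0⟩ := Submodule.exists_mem_ne_zero_of_ne_bot h0
  obtain ⟨q, hpq, hq⟩ := (FiniteMultiplicity.of_not_isUnit not_isUnit_X
    (Subtype.coe_injective.ne hp0)).exists_eq_pow_mul_and_not_dvd
  set k := multiplicity X (p : K[X])
  rw [X_dvd_iff, coeff_zero_eq_eval_zero] at hq
  obtain ⟨g, hg, hgq⟩ := exists_mul_mem_monoidAlg hS hq
  -- With `p = X^k q`, the product `X^(k+c) · gq` lies in `P`, while `gq` has constant term `1` and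
  -- so avoids `P`.
  have hXk : (⟨X ^ (k + c), X_pow_mem_monoidAlg_iff.2 (hc _ (by omega))⟩ : monoidAlg K S) ∈ P := by
    refine (hP.mem_or_mem (y := ⟨g * q, hgq⟩) ?_).resolve_right fun hgP => ?_
    · convert P.mul_mem_left ⟨X ^ c * g, X_pow_mul_mem_monoidAlg hc g⟩ hp using 1
      apply Subtype.ext
      change X ^ (k + c) * (g * q) = X ^ c * g * (p : K[X])
      rw [hpq]
      ring
    · have := mem_contractedIdeal.1 (h hgP)
      rw [X_dvd_iff, coeff_zero_eq_eval_zero, eval_mul, hg, inv_mul_cancel₀ hq] at this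
      exact one_ne_zero this
  intro a ha
  obtain ⟨b, hb⟩ := mem_contractedIdeal.1 ha
  -- The extra `c` in the exponent leaves a factor `X^c`, which keeps the cofactor of `X^(k+c)` in
  -- `K[S]`.
  refine hP.mem_of_pow_mem (k + c + c) ?_
  convert P.mul_mem_right ⟨X ^ c * b ^ (k + c + c), X_pow_mul_mem_monoidAlg hc _⟩ hXk using 1
  apply Subtype.ext
  change (a : K[X]) ^ (k + c + c) = X ^ (k + c) * (X ^ c * b ^ (k + c + c))
  rw [hb]
  ring

/-- By multiplicativity, a factorization `f = gh` puts the ideal of `g` or of `h` inside the prime.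
If it is that of `g`, then `f ∣ X^c g`, so `f ∣ g` and `h` is a unit. -/
theorem irreducible_of_isPrime_contractedIdeal (hS : IsNumericalMonoid S) {f : K[X]}
    (hf : f.eval 0 ≠ 0) (hP : (contractedIdeal S f).IsPrime) : Irreducible f := by
  obtain ⟨c, hc, -⟩ := hS.exists_conductor
  have key : ∀ g h : K[X], f = g * h → contractedIdeal S g ≤ contractedIdeal S f →
      IsUnit h := by
    intro g h hfgh hle
    have hg0 : g ≠ 0 := by
      rintro rfl
      rw [hfgh, zero_mul, eval_zero] at hf
      exact hf rfl
    have h1 : (⟨X ^ c * g, X_pow_mul_mem_monoidAlg hc g⟩ : monoidAlg K S) ∈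
        contractedIdeal S g := mem_contractedIdeal.2 (Dvd.intro_left _ rfl)
    have h2 := dvd_of_dvd_X_pow_mul hf (mem_contractedIdeal.1 (hle h1))
    rw [hfgh] at h2
    exact isUnit_of_dvd_one ((mul_dvd_mul_iff_left hg0).1 (by rwa [mul_one]))
  refine ⟨fun hu => hP.ne_top ?_, fun g h hfgh => ?_⟩
  · rw [Ideal.eq_top_iff_one, mem_contractedIdeal]
    exact hu.dvd
  · have hgh : g.eval 0 * h.eval 0 ≠ 0 := by rwa [← eval_mul, ← hfgh]
    have hmul := contractedIdeal_mul hS (left_ne_zero_of_mul hgh) (right_ne_zero_of_mul hgh)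
    rw [← hfgh] at hmul
    rcases hP.mul_le.1 hmul.le with hle | hle
    · exact Or.inr (key g h hfgh hle)
    · exact Or.inl (key h g (by rw [hfgh, mul_comm]) hle)

theorem isPrimeDivisor_contractedIdeal (hS : IsNumericalMonoid S) {f : K[X]}
    (hf : f.eval 0 ≠ 0) (hf' : Irreducible f) : IsPrimeDivisor (contractedIdeal S f) := by
  obtain ⟨c, hc, -⟩ := hS.exists_conductor
  have hfX : ∀ n, ¬ f ∣ X ^ n := fun n h => hf'.not_isUnit
    (isUnit_of_dvd_one (dvd_of_dvd_X_pow_mul hf (N := n) (by rwa [mul_one])))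
  have hprime : (contractedIdeal S f).IsPrime := by
    have := (Ideal.span_singleton_prime hf'.ne_zero).2 hf'.prime
    exact Ideal.comap_isPrime _ _
  refine ⟨hprime, le_antisymm ?_ ?_, isVInvertible_contractedIdeal hS hf⟩
  · rw [← Nat.cast_one, Ideal.height_le_iff]
    intro q hq hlt
    rw [Nat.cast_one, Order.lt_one_iff, Ideal.height_eq_zero_iff_eq_bot]
    by_contra hq0
    -- A nonzero prime inside `m` contains `m`, hence `X^(c+1)`, which `f` does not divide. Any
    -- other is given by an irreducible `g` with `f ∣ g`, so `g` is associated to `f` and the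
    -- inclusion is not strict.
    by_cases hqm : q ≤ contractedIdeal S X
    · refine hfX (c + 1) (mem_contractedIdeal.1 (hlt.le (contractedIdeal_X_le hS hq hq0 hqm
        (show (⟨X ^ (c + 1), X_pow_mem_monoidAlg_iff.2 (hc _ (by omega))⟩ : monoidAlg K S) ∈ _
          from ?_))))
      exact mem_contractedIdeal.2 (dvd_pow_self X c.succ_ne_zero)
    · obtain ⟨g, hg, rfl⟩ := exists_eq_contractedIdeal hS hqm
      have hg' := irreducible_of_isPrime_contractedIdeal hS hg hq
      have h1 : (⟨X ^ c * g, X_pow_mul_mem_monoidAlg hc g⟩ : monoidAlg K S) ∈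
          contractedIdeal S g := mem_contractedIdeal.2 (Dvd.intro_left _ rfl)
      have hfg := dvd_of_dvd_X_pow_mul hf (mem_contractedIdeal.1 (hlt.le h1))
      have hgf := (hf'.associated_of_dvd hg' hfg).symm.dvd
      exact hlt.not_ge fun a ha => mem_contractedIdeal.2 (hgf.trans (mem_contractedIdeal.1 ha))
  · rw [Order.one_le_iff_ne_zero, Ne, Ideal.height_eq_zero_iff_eq_bot]
    intro hbot
    have h1 : (⟨X ^ c * f, X_pow_mul_mem_monoidAlg hc f⟩ : monoidAlg K S) ∈
        contractedIdeal S f := mem_contractedIdeal.2 (Dvd.intro_left _ rfl)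
    rw [hbot, Ideal.mem_bot] at h1
    exact mul_ne_zero (pow_ne_zero c X_ne_zero) hf'.ne_zero (congrArg Subtype.val h1)

theorem IsPrimeDivisor.exists_irreducible (hS : IsNumericalMonoid S) (hS' : S ≠ ⊤)
    {P : Ideal (monoidAlg K S)} (hP : IsPrimeDivisor P) :
    ∃ f : K[X], f.eval 0 ≠ 0 ∧ Irreducible f ∧ P = contractedIdeal S f := by
  obtain ⟨hprime, hht, hinv⟩ := hP
  by_cases hPm : P ≤ contractedIdeal S X
  · have := contractedIdeal_X_le hS hprime (Ideal.ne_bot_of_height_eq_one hht) hPm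
    rw [le_antisymm hPm this] at hinv
    exact absurd (eval_X) (eval_ne_zero_of_isVInvertible hS hS' hinv)
  · obtain ⟨f, hf, rfl⟩ := exists_eq_contractedIdeal hS hPm
    exact ⟨f, hf, irreducible_of_isPrime_contractedIdeal hS hf hprime, rfl⟩

end MonoidAlgebra
-- The homomorphism `Θ` and its properties.
theorem exists_classGroup_hom {K : Type*} [Field K] {S T : AddSubmonoid ℕ}
    (hS : IsNumericalMonoid S) (hT : IsNumericalMonoid T) (hST : S ≤ T) :
    ∃ Θ : VClassGroup (monoidAlg K S) →* VClassGroup (monoidAlg K T),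
      ∀ (f : K[X]), f.eval 0 ≠ 0 → ∀ c : VClassGroup (monoidAlg K S),
        VClassContains c (contractedIdeal S f) → VClassContains (Θ c) (contractedIdeal T f) := by
  obtain ⟨φ, hφ⟩ := exists_contractedIdeal_class_hom (K := K) hS
  obtain ⟨ψ, hψ⟩ := exists_contractedIdeal_class_hom (K := K) hT
  have hφ1 : ∀ f, φ f = 1 ↔ (f : K[X]) ∈ monoidAlg K S := fun f => by
    rw [← vClassContains_one_contractedIdeal_iff hS f.2]
    exact ⟨fun h => h ▸ hφ f, fun h => (hφ f).unique h⟩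
  have hψ1 : ∀ f : nonzeroConstantTerm K, (f : K[X]) ∈ monoidAlg K T → ψ f = 1 := fun f hf =>
    (hψ f).unique ((vClassContains_one_contractedIdeal_iff hT f.2).2 hf)
  have hsurj : Function.Surjective φ := fun c => by
    obtain ⟨f, hf, hc⟩ := exists_vClassContains_contractedIdeal hS c
    exact ⟨⟨f, hf⟩, (hφ ⟨f, hf⟩).unique hc⟩
  have hker : ∀ a b, φ a = φ b → ψ a = ψ b := by
    intro a b hab
    -- The class of `g` is inverse to that of `b`, so `ga` and `gb` both lie in `K[S] ⊆ K[T]`, and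
    -- `g` cancels in the class group of `K[T]`.
    obtain ⟨g, hg, hgb⟩ := exists_mul_mem_monoidAlg hS b.2
    let g' : nonzeroConstantTerm K := ⟨g, by
      change g.eval 0 ≠ 0
      rw [hg]
      exact inv_ne_zero b.2⟩
    have hb : φ (g' * b) = 1 := (hφ1 _).2 hgb
    have ha : φ (g' * a) = 1 := by rw [map_mul, hab, ← map_mul, hb]
    have h1 := hψ1 _ (monoidAlg_mono hST ((hφ1 _).1 ha))
    rw [← hψ1 _ (monoidAlg_mono hST ((hφ1 _).1 hb)), map_mul, map_mul] at h1
    exact mul_left_cancel h1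
  obtain ⟨Θ, hΘ⟩ := φ.exists_factor_of_surjective ψ hsurj hker
  refine ⟨Θ, fun f hf c hc => ?_⟩
  rw [hc.unique (hφ ⟨f, hf⟩), hΘ]
  exact hψ ⟨f, hf⟩

/-- A map of class groups given by `[f K[X] ∩ K[S]] ↦ [f K[X] ∩ K[T]]` preserves classes with
prime divisors: every prime divisor of `K[S]` is the contraction of one of `K[T]` in the image
class. -/
theorem exists_isPrimeDivisor_comap_eq {K : Type*} [Field K] {S T : AddSubmonoid ℕ}
    (hS : IsNumericalMonoid S) (hT : IsNumericalMonoid T) (hST : S ≤ T)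
    {c : VClassGroup (monoidAlg K S)} {d : VClassGroup (monoidAlg K T)}
    (hcd : ∀ f : K[X], f.eval 0 ≠ 0 → VClassContains c (contractedIdeal S f) →
      VClassContains d (contractedIdeal T f))
    {P : Ideal (monoidAlg K S)} (hP : IsPrimeDivisor P) (hcP : VClassContains c P) :
    ∃ Q : Ideal (monoidAlg K T), IsPrimeDivisor Q ∧ VClassContains d Q ∧
      Q.comap (Subalgebra.inclusion (monoidAlg_mono (K := K) hST)) = P := by
  -- The case `S = ℕ` is separate because `XK[X]` is then a prime divisor not given by an `f` with
  -- `f(0) ≠ 0`.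
  by_cases hS' : S = ⊤
  · obtain rfl : S = T := le_antisymm hST (hS' ▸ le_top)
    obtain ⟨g, hg, hcg⟩ := exists_vClassContains_contractedIdeal hS c
    exact ⟨P, hP, (hcd g hg hcg).unique hcg ▸ hcP, rfl⟩
  · obtain ⟨f, hf, hirr, rfl⟩ := hP.exists_irreducible hS hS'
    exact ⟨contractedIdeal T f, isPrimeDivisor_contractedIdeal hT hf hirr, hcd f hf hcP,
      comap_contractedIdeal hST f⟩

theorem mainTheorem5 {K : Type*} [Field K] (S T : AddSubmonoid ℕ)
    (hS : IsNumericalMonoid S) (hT : IsNumericalMonoid T) (hST : S ≤ T) :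
    -- the ideals `fK[X] ∩ K[S]` with `f(0) ≠ 0` are `v`-invertible and represent all classes
    (∀ f : K[X], f.eval 0 ≠ 0 → IsVInvertible (contractedIdeal S f)) ∧
    (∀ c : VClassGroup (monoidAlg K S),
      ∃ f : K[X], f.eval 0 ≠ 0 ∧ VClassContains c (contractedIdeal S f)) ∧
    ∃ Θ : VClassGroup (monoidAlg K S) →* VClassGroup (monoidAlg K T),
      -- `Θ [fK[X] ∩ K[S]] = [fK[X] ∩ K[T]]`
      (∀ (f : K[X]) (c : VClassGroup (monoidAlg K S)),
        VClassContains c (contractedIdeal S f) → VClassContains (Θ c) (contractedIdeal T f)) ∧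
      Function.Surjective Θ ∧
      (∀ c : VClassGroup (monoidAlg K S),
        (∃ P : Ideal (monoidAlg K S), IsPrimeDivisor P ∧ VClassContains c P) →
          ∃ P : Ideal (monoidAlg K T), IsPrimeDivisor P ∧ VClassContains (Θ c) P) ∧
      (∀ c : VClassGroup (monoidAlg K S),
        {P : Ideal (monoidAlg K S) | IsPrimeDivisor P ∧ VClassContains c P}.Infinite →
          {P : Ideal (monoidAlg K T) | IsPrimeDivisor P ∧ VClassContains (Θ c) P}.Infinite) ∧
      (∀ c : VClassGroup (monoidAlg K S),
        c ∈ Θ.ker ↔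
          ∃ f : K[X], f ∈ monoidAlg K T ∧ f.eval 0 ≠ 0 ∧
            VClassContains c (contractedIdeal S f)) := by
  obtain ⟨Θ, hΘ⟩ := exists_classGroup_hom (K := K) hS hT hST
  refine ⟨fun f hf => isVInvertible_contractedIdeal hS hf,
    exists_vClassContains_contractedIdeal hS, Θ, ?_, ?_, ?_, ?_, ?_⟩
  · intro f c hc
    by_cases hS' : S = ⊤
    · obtain rfl : S = T := le_antisymm hST (hS' ▸ le_top)
      obtain ⟨g, hg, hcg⟩ := exists_vClassContains_contractedIdeal hS c
      rwa [(hΘ g hg c hcg).unique hcg]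
    · exact hΘ f (eval_ne_zero_of_isVInvertible hS hS' hc.isVInvertible) c hc
  · intro d
    obtain ⟨f, hf, hd⟩ := exists_vClassContains_contractedIdeal hT d
    obtain ⟨u, hu⟩ := isVInvertible_contractedIdeal hS hf
    exact ⟨QuotientGroup.mk u, (hΘ f hf _ ⟨u, hu, rfl⟩).unique hd⟩
  · rintro c ⟨P, hP, hcP⟩
    obtain ⟨Q, hQ, hcQ, -⟩ := exists_isPrimeDivisor_comap_eq hS hT hST
      (fun f hf => hΘ f hf c) hP hcP
    exact ⟨Q, hQ, hcQ⟩
  · intro c hinf hfin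
    -- Contraction to `K[S]` maps a finite set of primes onto a finite set, which would contain
    -- every prime divisor in `c`.
    refine hinf ((hfin.image (Ideal.comap
      (Subalgebra.inclusion (monoidAlg_mono (K := K) hST)))).subset ?_)
    rintro P ⟨hP, hcP⟩
    obtain ⟨Q, hQ, hcQ, hQP⟩ := exists_isPrimeDivisor_comap_eq hS hT hST
      (fun f hf => hΘ f hf c) hP hcP
    exact ⟨Q, ⟨hQ, hcQ⟩, hQP⟩
  · intro c
    rw [MonoidHom.mem_ker]
    constructor
    · intro hc
      obtain ⟨f, hf, hcf⟩ := exists_vClassContains_contractedIdeal hS c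
      have := hΘ f hf c hcf
      rw [hc, vClassContains_one_contractedIdeal_iff hT hf] at this
      exact ⟨f, this, hf, hcf⟩
    · rintro ⟨f, hfT, hf, hcf⟩
      exact (hΘ f hf c hcf).unique ((vClassContains_one_contractedIdeal_iff hT hf).2 hfT)
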